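/- Let $\mathbb F$ be $\mathbb R$ or $\mathbb C$, and let $d, n_1,\dots,n_d, m_1,\dots,m_d$ be nonnegative integers. Put $\mathcal X=\bigoplus_{k=1}^d \mathbb F^{n_k m_k}$, $\mathcal U_1=\mathcal Y_1=\mathbb F^p$, $\mathcal U_2=\mathbb F^q$, $\mathcal Y_2=\mathbb F^r$, and let $$\boldsymbol\Delta=\{\operatorname{diag}(\Delta^0_1\otimes I_{n_1},\dots,\Delta^0_d\otimes I_{n_d}) : \Delta^0_k\in\mathbb F^{m_k\times m_k}\}\subset\mathcal L(\mathcal X).$$ For a set $\boldsymbol S$ of square matrices let $\mathcal D_{\boldsymbol S}$ be its commutant $\{Q : QD=DQ \text{ for all } D\in\boldsymbol S\}$. A square matrix $M$ is called $\mathcal Q$-stable with respect to $\boldsymbol S$ if $\|Q^{-1}MQ\|<1$ (Euclidean operator norm) for some invertible $Q\in\mathcal D_{\boldsymbol S}$. Let a plant (LFT model) $$\begin{bmatrix} A&B_1&B_2\\ C_1&D_{11}&D_{12}\\ C_2&D_{21}&D_{22}\end{bmatrix}:\ \mathcal X\oplus\mathcal U_1\oplus\mathcal U_2\to\mathcal X\oplus\mathcal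 Y_1\oplus\mathcal Y_2$$ with uncertainty structure $\boldsymbol\Delta$ be given. A controller with access to the full block consists of nonnegative integers $n_{K1},\dots,n_{Kd},n_f$, a state space $\mathcal X_K=\bigoplus_{k=1}^d\mathbb F^{n_{Kk}m_k}\ \oplus\ \mathbb F^{p\, n_f}$ and a matrix $\begin{bmatrix}A_K&B_K\\ C_K&D_K\end{bmatrix}:\mathcal X_K\oplus\mathcal Y_2\to\mathcal X_K\oplus\mathcal U_2$ such that the feedback loop is well-posed, i.e. $I-D_{22}D_K$ is invertible (this is automatic if $D_{22}=0$). Its closed-loop system matrix on $(\mathcal X\oplus\mathcal X_K)\oplus\mathcal U_1$ is $$\begin{bmatrix}A_{cl}&B_{cl}\\ C_{cl}&D_{cl}\end{bmatrix}=\mathcal F_\ell\left(\left[\begin{array}{ccc|cc}A&0&B_1&0&B_2\\ 0&0&0&I&0\\ C_1&0&D_{11}&0&D_{12}\\ \hline 0&I&0&0&0\\ C_2&0&D_{21}&0&D_{22}\end{array}\right],\begin{bmatrix}A_K&B_K\\ C_K&D_K\end{bmatrix}\right),$$ where $\mathcal F_\ell\left(\begin{bmatrix}a&b\\ c&e\end{bmatrix},K\right)=a+b(I-Ke)^{-1}Kc$.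 The plant uncertainty and the artificial full-block uncertainty $\Delta_{\rm full}\in\mathcal L(\mathcal U_1)$, which feeds the error $y_1$ back to the disturbance $u_1$, are both shared with the controller: the closed-loop uncertainty structure $\boldsymbol\Delta_{sh}$ consists of all $$\operatorname{diag}\bigl(\Delta^0_1\otimes I_{n_1},\dots,\Delta^0_d\otimes I_{n_d},\ \Delta^0_1\otimes I_{n_{K1}},\dots,\Delta^0_d\otimes I_{n_{Kd}},\ \Delta_{\rm full}\otimes I_{n_f},\ \Delta_{\rm full}\bigr)$$ acting on $\mathcal X\oplus\mathcal X_K\oplus\mathcal U_1$, with arbitrary $\Delta_k^0\in\mathbb F^{m_k\times m_k}$ and $\Delta_{\rm full}\in\mathbb F^{p\times p}$. The controller achieves closed-loop $\mathcal Q$-performance if $\begin{bmatrix}A_{cl}&B_{cl}\\ C_{cl}&D_{cl}\end{bmatrix}$ is $\mathcal Q$-stable with respect to $\boldsymbol\Delta_{sh}$. Let $N_c$ and $N_o$ be any injective matrices with $\operatorname{Im}N_c=\operatorname{Ker}\begin{bmatrix}B_2^*&D_{12}^*\end{bmatrix}$ and $\operatorname{Im}N_o=\operatorname{Ker}\begin{bmatrix}C_2&D_{21}\end{bmatrix}$.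 **Theorem.** A controller with access to the full block (with no restriction on $n_{K1},\dots,n_{Kd},n_f$) which achieves closed-loop $\mathcal Q$-performance exists if and only if there are positive-definite $X,Y\in\mathcal D_{\boldsymbol\Delta}$ such that $$\begin{bmatrix}N_c&0\\0&I\end{bmatrix}^*\begin{bmatrix}AYA^*-Y&AYC_1^*&B_1\\ C_1YA^*&C_1YC_1^*-I&D_{11}\\ B_1^*&D_{11}^*&-I\end{bmatrix}\begin{bmatrix}N_c&0\\0&I\end{bmatrix}<0,$$ $$\begin{bmatrix}N_o&0\\0&I\end{bmatrix}^*\begin{bmatrix}A^*XA-X&A^*XB_1&C_1^*\\ B_1^*XA&B_1^*XB_1-I&D_{11}^*\\ C_1&D_{11}&-I\end{bmatrix}\begin{bmatrix}N_o&0\\0&I\end{bmatrix}<0.$$ -/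

import Mathlib

open Matrix
open scoped Kronecker ComplexOrder

noncomputable section

/-- Coordinates of the state space `𝒳 = ⨁ₖ 𝕜^(nₖ · mₖ)`: the `k`-th summand consists of `mₖ` blocks
of length `nₖ`. -/
abbrev StateIdx {d : ℕ} (m n : Fin d → ℕ) : Type := (k : Fin d) × (Fin (m k) × Fin (n k))

/-- The block-diagonal matrix `diag (Δ⁰₁ ⊗ I_{n₁}, …, Δ⁰_d ⊗ I_{n_d})`. -/
def uncertainty {𝕜 : Type*} [RCLike 𝕜] {d : ℕ} (m n : Fin d → ℕ)
    (δ : (k : Fin d) → Matrix (Fin (m k)) (Fin (m k)) 𝕜) :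
    Matrix (StateIdx m n) (StateIdx m n) 𝕜 :=
  Matrix.blockDiagonal' fun k => δ k ⊗ₖ (1 : Matrix (Fin (n k)) (Fin (n k)) 𝕜)

/-- The uncertainty structure `𝚫`: all `diag (Δ⁰₁ ⊗ I_{n₁}, …, Δ⁰_d ⊗ I_{n_d})`, where `Δ⁰ₖ` is an
arbitrary `mₖ × mₖ` matrix. -/
def uncertaintyStructure (𝕜 : Type*) [RCLike 𝕜] {d : ℕ} (m n : Fin d → ℕ) :
    Set (Matrix (StateIdx m n) (StateIdx m n) 𝕜) :=
  Set.range (uncertainty m n)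

/-- The commutant of a set of square matrices. -/
def commutant {𝕜 : Type*} [RCLike 𝕜] {ι : Type*} [Fintype ι] (S : Set (Matrix ι ι 𝕜)) :
    Set (Matrix ι ι 𝕜) :=
  {Q | ∀ D ∈ S, Q * D = D * Q}

open scoped Matrix.Norms.L2Operator in
/-- `𝒬`-stability of `M` with respect to the structure `S`: there is an invertible `Q` in the
commutant of `S` such that `‖Q⁻¹ M Q‖ < 1`, where the norm is the operator norm that is induced by
the Euclidean norm. -/
def QStable {𝕜 : Type*} [RCLike 𝕜] {ι : Type*} [Fintype ι] [DecidableEq ι]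
    (S : Set (Matrix ι ι 𝕜)) (M : Matrix ι ι 𝕜) : Prop :=
  ∃ Q ∈ commutant S, IsUnit Q ∧ ‖Q⁻¹ * M * Q‖ < 1

/-- The system matrix of a plant
`[A B₁ B₂; C₁ D₁₁ D₁₂; C₂ D₂₁ D₂₂] : 𝒳 ⊕ 𝒰₁ ⊕ 𝒰₂ → 𝒳 ⊕ 𝒴₁ ⊕ 𝒴₂`, where the coordinates of `𝒳` are
indexed by `χ`, and `𝒰₁ = 𝒴₁ = 𝕜^p`, `𝒰₂ = 𝕜^q`, `𝒴₂ = 𝕜^r`. -/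
structure Plant (𝕜 : Type*) (χ : Type*) (p q r : ℕ) where
  A : Matrix χ χ 𝕜
  B₁ : Matrix χ (Fin p) 𝕜
  B₂ : Matrix χ (Fin q) 𝕜
  C₁ : Matrix (Fin p) χ 𝕜
  C₂ : Matrix (Fin r) χ 𝕜
  D₁₁ : Matrix (Fin p) (Fin p) 𝕜
  D₁₂ : Matrix (Fin p) (Fin q) 𝕜
  D₂₁ : Matrix (Fin r) (Fin p) 𝕜
  D₂₂ : Matrix (Fin r) (Fin q) 𝕜

/-- The system matrix of a controller
`[A_K B_K; C_K D_K] : 𝒳_K ⊕ 𝒴₂ → 𝒳_K ⊕ 𝒰₂`, where the coordinates of `𝒳_K` are indexed by `κ`. -/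
structure Controller (𝕜 : Type*) (κ : Type*) (q r : ℕ) where
  A : Matrix κ κ 𝕜
  B : Matrix κ (Fin r) 𝕜
  C : Matrix (Fin q) κ 𝕜
  D : Matrix (Fin q) (Fin r) 𝕜

/-- The lower linear fractional transformation of `[A B; C D]` with load `K`:
`A + B (I - K D)⁻¹ K C`. -/
def lowerLFT {𝕜 : Type*} [RCLike 𝕜] {a b y u : Type*} [Fintype y] [Fintype u] [DecidableEq u]
    (A : Matrix a b 𝕜) (B : Matrix a u 𝕜) (C : Matrix y b 𝕜) (D : Matrix y u 𝕜)
    (K : Matrix u y 𝕜) : Matrix a b 𝕜 :=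
  A + B * (1 - K * D)⁻¹ * K * C

/-- The feedback loop is well-posed if `I - D₂₂ D_K` is invertible. -/
def WellPosed {𝕜 : Type*} [RCLike 𝕜] {χ κ : Type*} {p q r : ℕ}
    (P : Plant 𝕜 χ p q r) (K : Controller 𝕜 κ q r) : Prop :=
  IsUnit (1 - P.D₂₂ * K.D)

/-- The closed-loop system matrix `[A_cl B_cl; C_cl D_cl]` on `(𝒳 ⊕ 𝒳_K) ⊕ 𝒰₁`: the lower linear
fractional transformation with load `[A_K B_K; C_K D_K]` of
```
[ A   0  B₁  | 0  B₂  ]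
[ 0   0  0   | I  0   ]
[ C₁  0  D₁₁ | 0  D₁₂ ]
[---------------------]
[ 0   I  0   | 0  0   ]
[ C₂  0  D₂₁ | 0  D₂₂ ]
```
-/
def closedLoop {𝕜 : Type*} [RCLike 𝕜] {χ κ : Type*} [Fintype χ] [Fintype κ] [DecidableEq κ]
    {p q r : ℕ} (P : Plant 𝕜 χ p q r) (K : Controller 𝕜 κ q r) :
    Matrix ((χ ⊕ κ) ⊕ Fin p) ((χ ⊕ κ) ⊕ Fin p) 𝕜 :=
  lowerLFT
    (fromBlocks (fromBlocks P.A 0 0 0) (fromRows P.B₁ 0) (fromCols P.C₁ 0) P.D₁₁)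
    (fromRows (fromBlocks 0 P.B₂ 1 0) (fromCols 0 P.D₁₂))
    (fromCols (fromBlocks 0 1 P.C₂ 0) (fromRows 0 P.D₂₁))
    (fromBlocks 0 0 0 P.D₂₂)
    (fromBlocks K.A K.B K.C K.D)

/-- Coordinates of the state space of a controller that has access to the full block: the
partial states `(x_{K1}, …, x_{Kd})`, which are fed back through `Δ⁰ₖ ⊗ I_{n_{Kk}}`, and the
partial state `z`, which is fed back through `Δ⁰_full ⊗ I_{nf}`. -/
abbrev ControllerIdx {d : ℕ} (m nK : Fin d → ℕ) (p nf : ℕ) : Type :=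
  StateIdx m nK ⊕ (Fin p × Fin nf)

/-- The uncertainty structure of the closed loop in which both the plant uncertainty and the
artificial full-block uncertainty (which maps the error to the disturbance) are shared with the
controller: all matrices
`diag (diag (Δ⁰ₖ ⊗ I_{nₖ})ₖ, diag (Δ⁰ₖ ⊗ I_{n_{Kk}})ₖ, Δ_full ⊗ I_{nf}, Δ_full)` on
`𝒳 ⊕ 𝒳_K ⊕ 𝒰₁`, where the `Δ⁰ₖ` and `Δ_full ∈ ℒ(𝒰₁)` are arbitrary. -/
def sharedClosedLoopStructure (𝕜 : Type*) [RCLike 𝕜] {d : ℕ} (m n nK : Fin d → ℕ) (p nf : ℕ) :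
    Set (Matrix ((StateIdx m n ⊕ ControllerIdx m nK p nf) ⊕ Fin p)
      ((StateIdx m n ⊕ ControllerIdx m nK p nf) ⊕ Fin p) 𝕜) :=
  {E | ∃ (δ : (k : Fin d) → Matrix (Fin (m k)) (Fin (m k)) 𝕜) (δf : Matrix (Fin p) (Fin p) 𝕜),
    E = fromBlocks
      (fromBlocks (uncertainty m n δ) 0 0
        (fromBlocks (uncertainty m nK δ) 0 0 (δf ⊗ₖ (1 : Matrix (Fin nf) (Fin nf) 𝕜))))
      0 0 δf}

/-- `N` is injective and its image is the kernel of `M`. -/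
def IsKernelMatrix {𝕜 : Type*} [RCLike 𝕜] {a b : Type*} [Fintype b] {c : ℕ}
    (N : Matrix b (Fin c) 𝕜) (M : Matrix a b 𝕜) : Prop :=
  Function.Injective N.mulVec ∧ LinearMap.range N.mulVecLin = LinearMap.ker M.mulVecLin

/-- The `Y`-LMI:
`diag(N, I)* [AYA* - Y, AYC₁*, B₁; C₁YA*, C₁YC₁* - I, D₁₁; B₁*, D₁₁*, -I] diag(N, I) < 0`. -/
def YLMI {𝕜 : Type*} [RCLike 𝕜] {χ : Type*} [Fintype χ] {p q r c : ℕ}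
    (P : Plant 𝕜 χ p q r) (N : Matrix (χ ⊕ Fin p) (Fin c) 𝕜) (Y : Matrix χ χ 𝕜) : Prop :=
  (-((fromBlocks N 0 0 (1 : Matrix (Fin p) (Fin p) 𝕜))ᴴ *
    fromBlocks
      (fromBlocks (P.A * Y * P.Aᴴ - Y) (P.A * Y * P.C₁ᴴ)
        (P.C₁ * Y * P.Aᴴ) (P.C₁ * Y * P.C₁ᴴ - 1))
      (fromRows P.B₁ P.D₁₁)
      (fromCols P.B₁ᴴ P.D₁₁ᴴ)
      (-1) *
    fromBlocks N 0 0 (1 : Matrix (Fin p) (Fin p) 𝕜))).PosDef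

/-- The `X`-LMI:
`diag(N, I)* [A*XA - X, A*XB₁, C₁*; B₁*XA, B₁*XB₁ - I, D₁₁*; C₁, D₁₁, -I] diag(N, I) < 0`. -/
def XLMI {𝕜 : Type*} [RCLike 𝕜] {χ : Type*} [Fintype χ] {p q r c : ℕ}
    (P : Plant 𝕜 χ p q r) (N : Matrix (χ ⊕ Fin p) (Fin c) 𝕜) (X : Matrix χ χ 𝕜) : Prop :=
  (-((fromBlocks N 0 0 (1 : Matrix (Fin p) (Fin p) 𝕜))ᴴ *
    fromBlocks
      (fromBlocks (P.Aᴴ * X * P.A - X) (P.Aᴴ * X * P.B₁)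
        (P.B₁ᴴ * X * P.A) (P.B₁ᴴ * X * P.B₁ - 1))
      (fromRows P.C₁ᴴ P.D₁₁ᴴ)
      (fromCols P.C₁ P.D₁₁)
      (-1) *
    fromBlocks N 0 0 (1 : Matrix (Fin p) (Fin p) 𝕜))).PosDef

end

/-!
A matrix `M` is `𝒬`-stable iff some positive-definite `W` in the commutant satisfies the Stein
inequality `W - Mᴴ W M > 0`. On plant coordinates the closed loop differs from the open loop
`[A B₁; C₁ D₁₁]` only by a multiple of the observation `[C₂ D₂₁]`, so a Stein certificate of the
closed loop, restricted to plant coordinates and to the kernel of the observation, is the `X`-LMI up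
to a Schur complement; since the full block is arbitrary, the certificate is a multiple of the
identity on `𝒰₁`. The `Y`-LMI is the `X`-LMI of the dual plant.

Conversely, the `X`-LMI yields an output injection `L` and the `Y`-LMI a feedback `F` such that
`[A B₁; C₁ D₁₁] + L [C₂ D₂₁]` and `[A B₁; C₁ D₁₁] + [B₂; D₁₂] F` are `𝒬`-stable. Access to the full
block lets an observer estimate the disturbance together with the state. In the coordinates
(plant, estimation error) the resulting closed loop is block triangular with these two matrices on
the diagonal, and scaling makes the off-diagonal block irrelevant.
-/

section Norm

theorem opNorm_lt_one_iff_forall_norm_lt {𝕜 E F : Type*} [RCLike 𝕜] [NormedAddCommGroup E]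
    [NormedSpace 𝕜 E] [ProperSpace E] [SeminormedAddCommGroup F] [NormedSpace 𝕜 F] (f : E →L[𝕜] F) :
    ‖f‖ < 1 ↔ ∀ x ≠ 0, ‖f x‖ < ‖x‖ := by
  refine ⟨fun hf x hx => ?_, fun hf => ?_⟩
  · calc ‖f x‖ ≤ ‖f‖ * ‖x‖ := f.le_opNorm x
      _ < ‖x‖ := mul_lt_of_lt_one_left (norm_pos_iff.2 hx) hf
  · rcases subsingleton_or_nontrivial E with hE | hE
    · simp [ContinuousLinearMap.opNorm_subsingleton]
    · obtain ⟨y, hy⟩ := exists_ne (0 : E)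
      obtain ⟨x, hx, hmax⟩ := (isCompact_sphere (0 : E) 1).exists_isMaxOn
        ⟨(‖y‖⁻¹ : 𝕜) • y, by simpa using norm_smul_inv_norm hy⟩ f.continuous.norm.continuousOn
      rw [mem_sphere_zero_iff_norm] at hx
      calc ‖f‖ ≤ ‖f x‖ := ContinuousLinearMap.opNorm_le_of_unit_norm (norm_nonneg _)
              fun z hz => hmax (mem_sphere_zero_iff_norm.2 hz)
        _ < ‖x‖ := hf x (norm_ne_zero_iff.1 (hx ▸ one_ne_zero))
        _ = 1 := hx

variable {𝕜 ι : Type*} [RCLike 𝕜] [Fintype ι] [DecidableEq ι]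

theorem dotProduct_one_sub_conjTranspose_mul_self_mulVec (T : Matrix ι ι 𝕜)
    (x : EuclideanSpace 𝕜 ι) :
    star x.ofLp ⬝ᵥ (1 - Tᴴ * T) *ᵥ x.ofLp =
      ((‖x‖ ^ 2 - ‖toEuclideanCLM (n := ι) (𝕜 := 𝕜) T x‖ ^ 2 : ℝ) : 𝕜) := by
  push_cast
  rw [← inner_self_eq_norm_sq_to_K (𝕜 := 𝕜), ← inner_self_eq_norm_sq_to_K (𝕜 := 𝕜),
    EuclideanSpace.inner_eq_star_dotProduct, EuclideanSpace.inner_eq_star_dotProduct,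
    ofLp_toEuclideanCLM, sub_mulVec, dotProduct_sub, one_mulVec, ← mulVec_mulVec,
    dotProduct_mulVec _ Tᴴ, ← star_mulVec, dotProduct_comm, dotProduct_comm (T *ᵥ _)]

open scoped Matrix.Norms.L2Operator

theorem l2_opNorm_lt_one_iff_posDef (T : Matrix ι ι 𝕜) : ‖T‖ < 1 ↔ (1 - Tᴴ * T).PosDef := by
  have form_pos_iff (x : EuclideanSpace 𝕜 ι) :
      0 < star x.ofLp ⬝ᵥ (1 - Tᴴ * T) *ᵥ x.ofLp ↔
        ‖toEuclideanCLM (n := ι) (𝕜 := 𝕜) T x‖ < ‖x‖ := by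
    rw [dotProduct_one_sub_conjTranspose_mul_self_mulVec, RCLike.ofReal_pos, sub_pos,
      pow_lt_pow_iff_left₀ (norm_nonneg _) (norm_nonneg _) two_ne_zero]
  rw [cstar_norm_def, opNorm_lt_one_iff_forall_norm_lt]
  refine ⟨fun h => .of_dotProduct_mulVec_pos (by simp [IsHermitian]) fun x hx => ?_,
    fun h x hx => (form_pos_iff x).1 (h.dotProduct_mulVec_pos (by simpa using hx))⟩
  exact (form_pos_iff (WithLp.toLp 2 x)).2 (h _ (by simpa using hx))

theorem l2_opNorm_conj_lt_one_iff_posDef {Q : Matrix ι ι 𝕜} (hQ : IsUnit Q) (M : Matrix ι ι 𝕜) :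
    ‖Q⁻¹ * M * Q‖ < 1 ↔ (Q⁻¹ᴴ * Q⁻¹ - Mᴴ * (Q⁻¹ᴴ * Q⁻¹) * M).PosDef := by
  have hQQ : Q * Q⁻¹ = 1 := Matrix.mul_nonsing_inv _ ((isUnit_iff_isUnit_det _).1 hQ)
  have hQQ' : Q⁻¹ᴴ * Qᴴ = 1 := by rw [← conjTranspose_mul, hQQ, conjTranspose_one]
  have hcongr : Q⁻¹ᴴ * Q⁻¹ - Mᴴ * (Q⁻¹ᴴ * Q⁻¹) * M =
      star Q⁻¹ * (1 - (Q⁻¹ * M * Q)ᴴ * (Q⁻¹ * M * Q)) * Q⁻¹ := by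
    have hstar : star Q⁻¹ = Q⁻¹ᴴ := rfl
    calc Q⁻¹ᴴ * Q⁻¹ - Mᴴ * (Q⁻¹ᴴ * Q⁻¹) * M
        = Q⁻¹ᴴ * Q⁻¹ - (Q⁻¹ᴴ * Qᴴ) * Mᴴ * (Q⁻¹ᴴ * Q⁻¹) * M * (Q * Q⁻¹) := by
          rw [hQQ, hQQ', Matrix.one_mul, Matrix.mul_one]
      _ = star Q⁻¹ * (1 - (Q⁻¹ * M * Q)ᴴ * (Q⁻¹ * M * Q)) * Q⁻¹ := by
          simp only [hstar, conjTranspose_mul, Matrix.mul_sub, Matrix.sub_mul, Matrix.mul_one,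
            Matrix.mul_assoc]
  rw [l2_opNorm_lt_one_iff_posDef, hcongr,
    Matrix.IsUnit.posDef_star_left_conjugate_iff (isUnit_nonsing_inv_iff.2 hQ)]

end Norm

section Commutant

variable {𝕜 ι : Type*} [RCLike 𝕜] [Fintype ι] {S : Set (Matrix ι ι 𝕜)} {P Q : Matrix ι ι 𝕜}

theorem commutant_eq_centralizer (S : Set (Matrix ι ι 𝕜)) : commutant S = S.centralizer :=
  Set.ext fun _ => forall₂_congr fun _ _ => eq_comm

theorem mul_mem_commutant (hP : P ∈ commutant S) (hQ : Q ∈ commutant S) :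
    P * Q ∈ commutant S := by
  rw [commutant_eq_centralizer] at *
  exact Set.mul_mem_centralizer hP hQ

theorem inv_mem_commutant [DecidableEq ι] (hQ : Q ∈ commutant S) : Q⁻¹ ∈ commutant S := by
  intro D hD
  rw [← Matrix.zpow_neg_one]
  exact Matrix.Commute.zpow_left (hQ D hD) (-1)

theorem conjTranspose_mem_commutant (hS : ∀ D ∈ S, Dᴴ ∈ S) (hQ : Q ∈ commutant S) :
    Qᴴ ∈ commutant S := by
  rw [commutant_eq_centralizer] at *
  exact Set.star_mem_centralizer' hS hQ

end Commutant

section Lyapunov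

variable {𝕜 ι : Type*} [RCLike 𝕜] [Fintype ι] {S : Set (Matrix ι ι 𝕜)}

open scoped MatrixOrder Matrix.Norms.L2Operator in
theorem exists_isUnit_sqrt_mem_commutant [DecidableEq ι] {W : Matrix ι ι 𝕜} (hW : W.PosDef)
    (hWS : W ∈ commutant S) : ∃ R ∈ commutant S, IsUnit R ∧ Rᴴ * R = W := by
  have hsq : CFC.sqrt W * CFC.sqrt W = W := CFC.sqrt_mul_sqrt_self W hW.posSemidef.nonneg
  refine ⟨CFC.sqrt W, fun D hD => ?_, isUnit_of_mul_isUnit_left (hsq.symm ▸ hW.isUnit), ?_⟩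
  · rw [CFC.sqrt_eq_cfc]
    exact Commute.cfc_nnreal (hWS D hD) _
  · rw [(CFC.sqrt_nonneg W).posSemidef.isHermitian.eq, hsq]

theorem qStable_iff_exists_posDef [DecidableEq ι] (hS : ∀ D ∈ S, Dᴴ ∈ S) {M : Matrix ι ι 𝕜} :
    QStable S M ↔ ∃ W ∈ commutant S, W.PosDef ∧ (W - Mᴴ * W * M).PosDef := by
  constructor
  · rintro ⟨Q, hQ, hu, hn⟩
    have hQi := inv_mem_commutant hQ
    refine ⟨Q⁻¹ᴴ * Q⁻¹, mul_mem_commutant (conjTranspose_mem_commutant hS hQi) hQi, ?_,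
      (l2_opNorm_conj_lt_one_iff_posDef hu M).1 hn⟩
    exact .conjTranspose_mul_self _ (mulVec_injective_of_isUnit (isUnit_nonsing_inv_iff.2 hu))
  · rintro ⟨W, hWS, hW, h⟩
    obtain ⟨R, hR, hu, rfl⟩ := exists_isUnit_sqrt_mem_commutant hW hWS
    have hu' : IsUnit R⁻¹ := isUnit_nonsing_inv_iff.2 hu
    refine ⟨R⁻¹, inv_mem_commutant hR, hu', (l2_opNorm_conj_lt_one_iff_posDef hu' M).2 ?_⟩
    rwa [Matrix.nonsing_inv_nonsing_inv _ ((isUnit_iff_isUnit_det _).1 hu)]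

open scoped Matrix.Norms.L2Operator in
theorem QStable.conjTranspose [DecidableEq ι] (hS : ∀ D ∈ S, Dᴴ ∈ S) {M : Matrix ι ι 𝕜}
    (h : QStable S M) : QStable S Mᴴ := by
  obtain ⟨Q, hQ, hu, hn⟩ := h
  have hu' : IsUnit Qᴴ := hu.star
  refine ⟨Qᴴ⁻¹, inv_mem_commutant (conjTranspose_mem_commutant hS hQ),
    isUnit_nonsing_inv_iff.2 hu', ?_⟩
  rw [← l2_opNorm_conjTranspose] at hn
  rw [Matrix.nonsing_inv_nonsing_inv _ ((isUnit_iff_isUnit_det _).1 hu')]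
  simpa only [conjTranspose_mul, conjTranspose_nonsing_inv, Matrix.mul_assoc] using hn

end Lyapunov

section BlockDiagonal

variable {ι κ : Type*}

theorem posDef_fromBlocks_diagonal {R : Type*} [Ring R] [PartialOrder R] [StarRing R]
    [AddLeftMono R] {A : Matrix ι ι R} {B : Matrix κ κ R} (hA : A.PosDef) (hB : B.PosDef) :
    (fromBlocks A 0 0 B).PosDef := by
  refine ⟨hA.isHermitian.fromBlocks conjTranspose_zero hB.isHermitian, fun v hv => ?_⟩
  obtain ⟨x, y, rfl⟩ : ∃ x y, v = Finsupp.sumElim x y :=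
    ⟨_, _, (Finsupp.comapDomain_sumElim_comapDomain v).symm⟩
  have hform : ((x.sumElim y).sum fun i vi => (x.sumElim y).sum fun j vj =>
        star vi * fromBlocks A 0 0 B i j * vj) =
      (x.sum fun i xi => x.sum fun j xj => star xi * A i j * xj) +
        y.sum fun i yi => y.sum fun j yj => star yi * B i j * yj := by
    simp [Finsupp.sum_sumElim, Function.comp_def]
  rw [hform]
  by_cases hx : x = 0
  · have hy : y ≠ 0 := by
      rintro rfl
      exact hv (by rw [hx, Finsupp.sumElim_zero_zero])
    exact add_pos_of_nonneg_of_pos (hA.posSemidef.2 x) (hB.2 hy)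
  · exact add_pos_of_pos_of_nonneg (hA.2 hx) (hB.posSemidef.2 y)

/-- The structure of all `diag (D, D')` with `D ∈ S` and `D' ∈ S'`. The structure `S` augmented by
a full block is `blockDiagonalStructure S Set.univ`. -/
def blockDiagonalStructure {R : Type*} [Zero R] (S : Set (Matrix ι ι R)) (S' : Set (Matrix κ κ R)) :
    Set (Matrix (ι ⊕ κ) (ι ⊕ κ) R) :=
  Set.image2 (fun D D' => fromBlocks D 0 0 D') S S'

theorem conjTranspose_mem_blockDiagonalStructure {R : Type*} [AddMonoid R] [StarAddMonoid R]
    {S : Set (Matrix ι ι R)} {S' : Set (Matrix κ κ R)} (hS : ∀ D ∈ S, Dᴴ ∈ S)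
    (hS' : ∀ D ∈ S', Dᴴ ∈ S') :
    ∀ D ∈ blockDiagonalStructure S S', Dᴴ ∈ blockDiagonalStructure S S' := by
  rintro _ ⟨D, hD, D', hD', rfl⟩
  exact ⟨Dᴴ, hS D hD, D'ᴴ, hS' D' hD', by simp [fromBlocks_conjTranspose]⟩

variable {𝕜 : Type*} [RCLike 𝕜] {S : Set (Matrix ι ι 𝕜)} {S' : Set (Matrix κ κ 𝕜)}
  [Fintype ι] [Fintype κ]

theorem fromBlocks_mem_commutant_blockDiagonalStructure {Q : Matrix ι ι 𝕜} {Q' : Matrix κ κ 𝕜}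
    (hQ : Q ∈ commutant S) (hQ' : Q' ∈ commutant S') :
    fromBlocks Q 0 0 Q' ∈ commutant (blockDiagonalStructure S S') := by
  rintro _ ⟨D, hD, D', hD', rfl⟩
  simp [fromBlocks_multiply, hQ D hD, hQ' D' hD']

open scoped Matrix.Norms.L2Operator Topology
open Filter

theorem l2_opNorm_fromBlocks_diagonal_lt_one [DecidableEq ι] [DecidableEq κ] {a : Matrix ι ι 𝕜}
    {c : Matrix κ κ 𝕜} (ha : ‖a‖ < 1) (hc : ‖c‖ < 1) : ‖fromBlocks a 0 0 c‖ < 1 := by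
  rw [l2_opNorm_lt_one_iff_posDef] at *
  convert posDef_fromBlocks_diagonal ha hc using 1
  simp [fromBlocks_conjTranspose, fromBlocks_multiply, ← fromBlocks_one, sub_eq_add_neg,
    fromBlocks_neg, fromBlocks_add]

-- Conjugation with `diag (1, ε)` multiplies the off-diagonal block by `ε`.
theorem QStable.fromBlocks_upper [DecidableEq ι] [DecidableEq κ] {a : Matrix ι ι 𝕜}
    {c : Matrix κ κ 𝕜} (ha : QStable S a) (b : Matrix ι κ 𝕜) (hc : QStable S' c) :
    QStable (blockDiagonalStructure S S') (fromBlocks a b 0 c) := by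
  obtain ⟨Q, hQ, hQu, hQn⟩ := ha
  obtain ⟨R, hR, hRu, hRn⟩ := hc
  have hQQ : Q⁻¹ * Q = 1 := Matrix.nonsing_inv_mul _ ((isUnit_iff_isUnit_det _).1 hQu)
  have hRR : R⁻¹ * R = 1 := Matrix.nonsing_inv_mul _ ((isUnit_iff_isUnit_det _).1 hRu)
  let Δ : Matrix (ι ⊕ κ) (ι ⊕ κ) 𝕜 := fromBlocks (Q⁻¹ * a * Q) 0 0 (R⁻¹ * c * R)
  let β : Matrix (ι ⊕ κ) (ι ⊕ κ) 𝕜 := fromBlocks 0 (Q⁻¹ * b * R) 0 0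
  have hΔ : ‖Δ‖ < 1 := l2_opNorm_fromBlocks_diagonal_lt_one hQn hRn
  obtain ⟨ε, hεn, hε⟩ : ∃ ε : 𝕜, ‖Δ + ε • β‖ < 1 ∧ ε ≠ 0 := by
    have hcont : Continuous fun ε : 𝕜 => ‖Δ + ε • β‖ := by fun_prop
    have hev : ∀ᶠ ε in 𝓝 (0 : 𝕜), ‖Δ + ε • β‖ < 1 :=
      hcont.continuousAt.eventually_lt_const (by simpa using hΔ)
    exact ((hev.filter_mono (nhdsWithin_le_nhds (s := {0}ᶜ))).and self_mem_nhdsWithin).exists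
  have hinv : fromBlocks Q⁻¹ 0 0 (ε⁻¹ • R⁻¹) * fromBlocks Q 0 0 (ε • R) = 1 := by
    simp [fromBlocks_multiply, hQQ, hRR, smul_smul, hε]
  have hεR : ε • R ∈ commutant S' := fun D hD => by rw [Matrix.smul_mul, Matrix.mul_smul, hR D hD]
  refine ⟨fromBlocks Q 0 0 (ε • R), fromBlocks_mem_commutant_blockDiagonalStructure hQ hεR,
    .of_mul_eq_one_right _ hinv, ?_⟩
  rw [Matrix.inv_eq_left_inv hinv]
  convert hεn using 2
  simp [Δ, β, fromBlocks_multiply, fromBlocks_smul, fromBlocks_add, smul_smul, hε]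

end BlockDiagonal

section Intertwining

variable {𝕜 ι κ γ : Type*} [RCLike 𝕜] [Fintype ι] [Fintype κ]

/-- `U` intertwines the structure `S'` with the structure `S`: every `D' ∈ S'` is carried by `U` to
some `D ∈ S`. The second equation lets positive-definite elements of `commutant S` be pulled back
along `U`. -/
def Intertwines (U : Matrix κ ι 𝕜) (S' : Set (Matrix ι ι 𝕜)) (S : Set (Matrix κ κ 𝕜)) : Prop :=
  ∀ D' ∈ S', ∃ D ∈ S, D * U = U * D' ∧ Dᴴ * U = U * D'ᴴ

variable {S' : Set (Matrix ι ι 𝕜)} {S : Set (Matrix κ κ 𝕜)} {U : Matrix κ ι 𝕜}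

theorem Intertwines.conjTranspose_mul_mul_mem_commutant (hU : Intertwines U S' S)
    {W : Matrix κ κ 𝕜} (hW : W ∈ commutant S) : Uᴴ * W * U ∈ commutant S' := by
  intro D' hD'
  obtain ⟨D, hD, hDU, hDU'⟩ := hU D' hD'
  have hUD : Uᴴ * D = D' * Uᴴ := by simpa using congrArg Matrix.conjTranspose hDU'
  calc Uᴴ * W * U * D' = Uᴴ * (W * D) * U := by simp only [Matrix.mul_assoc, hDU]
    _ = D' * (Uᴴ * W * U) := by
      rw [hW D hD]
      simp only [← Matrix.mul_assoc, hUD]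

variable [DecidableEq κ] {M : Matrix κ κ 𝕜} {M' : Matrix ι ι 𝕜}

theorem QStable.exists_posDef_of_intertwines [Fintype γ] (hS : ∀ D ∈ S, Dᴴ ∈ S)
    (hM : QStable S M) (hU : Intertwines U S' S) (hUi : Function.Injective U.mulVec)
    {N : Matrix ι γ 𝕜} (hN : Function.Injective N.mulVec) (hMU : M * (U * N) = U * (M' * N)) :
    ∃ W ∈ commutant S', W.PosDef ∧ (Nᴴ * (W - M'ᴴ * W * M') * N).PosDef := by
  obtain ⟨W, hWS, hW, hstein⟩ := (qStable_iff_exists_posDef hS).1 hM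
  refine ⟨Uᴴ * W * U, hU.conjTranspose_mul_mul_mem_commutant hWS,
    hW.conjTranspose_mul_mul_same hUi, ?_⟩
  have hMU' : Nᴴ * Uᴴ * Mᴴ = Nᴴ * M'ᴴ * Uᴴ := by
    simpa [Matrix.mul_assoc] using congrArg Matrix.conjTranspose hMU
  have hpull : Nᴴ * (Uᴴ * W * U - M'ᴴ * (Uᴴ * W * U) * M') * N =
      Nᴴ * (Uᴴ * (W - Mᴴ * W * M) * U) * N := by
    calc Nᴴ * (Uᴴ * W * U - M'ᴴ * (Uᴴ * W * U) * M') * N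
        = Nᴴ * Uᴴ * W * U * N - Nᴴ * M'ᴴ * Uᴴ * W * (U * (M' * N)) := by
          simp only [Matrix.mul_sub, Matrix.sub_mul, Matrix.mul_assoc]
      _ = Nᴴ * (Uᴴ * (W - Mᴴ * W * M) * U) * N := by
          rw [← hMU, ← hMU']
          simp only [Matrix.mul_sub, Matrix.sub_mul, Matrix.mul_assoc]
  rw [hpull]
  exact (hstein.conjTranspose_mul_mul_same hUi).conjTranspose_mul_mul_same hN

theorem QStable.of_intertwines [DecidableEq ι] (hS : ∀ D ∈ S, Dᴴ ∈ S) (hS' : ∀ D ∈ S', Dᴴ ∈ S')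
    (hM : QStable S M) (hU : Intertwines U S' S) (hUi : Function.Injective U.mulVec)
    (hMU : M * U = U * M') : QStable S' M' := by
  obtain ⟨W, hWS, hW, hstein⟩ := hM.exists_posDef_of_intertwines hS hU hUi
    (mulVec_injective_of_isUnit isUnit_one) (N := 1) (by simpa using hMU)
  exact (qStable_iff_exists_posDef hS').2 ⟨W, hWS, hW, by simpa using hstein⟩

end Intertwining

section OutputInjection

theorem mulVec_injective_of_mul_eq_one {R a b : Type*} [Semiring R] [Fintype a] [Fintype b]
    [DecidableEq b] {U : Matrix a b R} {V : Matrix b a R} (h : V * U = 1) :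
    Function.Injective U.mulVec :=
  Function.LeftInverse.injective (g := V.mulVec) fun x => by rw [mulVec_mulVec, h, one_mulVec]

theorem exists_linearMap_comp_eq_of_ker_le_ker {K V V₁ V₂ : Type*} [DivisionRing K]
    [AddCommGroup V] [Module K V] [AddCommGroup V₁] [Module K V₁] [AddCommGroup V₂] [Module K V₂]
    {f : V →ₗ[K] V₁} {g : V →ₗ[K] V₂} (h : LinearMap.ker f ≤ LinearMap.ker g) :
    ∃ k : V₁ →ₗ[K] V₂, k ∘ₗ f = g := by
  obtain ⟨s, hs⟩ := ((LinearMap.ker f).liftQ f le_rfl).exists_leftInverse_of_injective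
    (Submodule.ker_liftQ_eq_bot _ _ _ le_rfl)
  refine ⟨(LinearMap.ker f).liftQ g h ∘ₗ s, LinearMap.ext fun x => ?_⟩
  have hsx : s (f x) = Submodule.Quotient.mk x := LinearMap.congr_fun hs (Submodule.Quotient.mk x)
  simp [hsx]

theorem exists_mul_eq_of_ker_le_ker {K a b e : Type*} [Field K] [Fintype a] [Fintype b]
    {C : Matrix a b K} {T : Matrix e b K}
    (h : LinearMap.ker C.mulVecLin ≤ LinearMap.ker T.mulVecLin) :
    ∃ L : Matrix e a K, L * C = T := by
  classical
  obtain ⟨k, hk⟩ := exists_linearMap_comp_eq_of_ker_le_ker h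
  refine ⟨LinearMap.toMatrix' k, Matrix.ext_of_mulVec_single fun i => ?_⟩
  rw [← mulVec_mulVec, LinearMap.toMatrix'_mulVec]
  exact LinearMap.congr_fun hk _

variable {𝕜 : Type*} [RCLike 𝕜]

theorem exists_mul_eq_one_and_isHermitian {b c : Type*} [Fintype b] [Fintype c] [DecidableEq c]
    {X : Matrix b b 𝕜} (hX : X.PosDef) {N : Matrix b c 𝕜} (hN : Function.Injective N.mulVec) :
    ∃ K : Matrix c b 𝕜, K * N = 1 ∧ (X * (N * K)).IsHermitian := by
  have hG : (Nᴴ * X * N).PosDef := hX.conjTranspose_mul_mul_same hN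
  refine ⟨(Nᴴ * X * N)⁻¹ * Nᴴ * X, ?_, ?_⟩
  · rw [Matrix.mul_assoc, Matrix.mul_assoc, ← Matrix.mul_assoc Nᴴ,
      Matrix.nonsing_inv_mul _ ((isUnit_iff_isUnit_det _).1 hG.isUnit)]
  · simpa [hX.isHermitian.eq, Matrix.mul_assoc] using
      isHermitian_mul_mul_conjTranspose (X * N) hG.isHermitian.inv

variable {a b : Type*} [Fintype b] {c : ℕ} {N : Matrix b (Fin c) 𝕜} {C : Matrix a b 𝕜}

theorem IsKernelMatrix.mul_eq_zero (h : IsKernelMatrix N C) : C * N = 0 := by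
  refine Matrix.ext_of_mulVec_single fun i => ?_
  have hmem : N.mulVecLin (Pi.single i 1) ∈ LinearMap.ker C.mulVecLin := h.2 ▸ ⟨_, rfl⟩
  rw [← mulVec_mulVec, zero_mulVec]
  exact hmem

theorem IsKernelMatrix.exists_mul_eq [Fintype a] (h : IsKernelMatrix N C) {e : Type*}
    {T : Matrix e b 𝕜} (hT : T * N = 0) : ∃ L : Matrix e a 𝕜, L * C = T := by
  refine exists_mul_eq_of_ker_le_ker ?_
  rw [← h.2]
  rintro _ ⟨w, rfl⟩
  simp [mulVec_mulVec, hT]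

-- `L` is chosen so that `M + L C = M E`, where `E = N K` is the `X`-orthogonal projection onto
-- `Ker C`.
theorem IsKernelMatrix.exists_posDef_add_mul [Fintype a] (h : IsKernelMatrix N C)
    {M X : Matrix b b 𝕜} (hX : X.PosDef) (hN : (Nᴴ * (X - Mᴴ * X * M) * N).PosDef) :
    ∃ L : Matrix b a 𝕜, (X - (M + L * C)ᴴ * X * (M + L * C)).PosDef := by
  classical
  obtain ⟨K, hKN, hK⟩ := exists_mul_eq_one_and_isHermitian hX h.1
  obtain ⟨L, hL⟩ := h.exists_mul_eq (T := M * (N * K) - M) (by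
    simp [Matrix.sub_mul, Matrix.mul_assoc, hKN])
  refine ⟨L, ?_⟩
  rw [hL, add_sub_cancel]
  set Z := Nᴴ * (X - Mᴴ * X * M) * N with hZ
  have hXE : (N * K)ᴴ * X = X * (N * K) := by simpa [hX.isHermitian.eq] using hK.eq
  have hEE : N * K * (N * K) = N * K := by
    rw [Matrix.mul_assoc, ← Matrix.mul_assoc K, hKN, Matrix.one_mul]
  have hinj : Function.Injective (fromRows (1 - N * K) K).mulVec :=
    mulVec_injective_of_mul_eq_one (V := fromCols 1 N) (by simp [fromCols_mul_fromRows])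
  have hpyth : X = (1 - N * K)ᴴ * X * (1 - N * K) + (N * K)ᴴ * X * (N * K) := by
    simp only [conjTranspose_sub, conjTranspose_one, Matrix.sub_mul, Matrix.one_mul, hXE,
      Matrix.mul_sub, Matrix.mul_one, Matrix.mul_assoc X, hEE]
    abel
  have hZK : Kᴴ * Z * K = (N * K)ᴴ * X * (N * K) - (M * (N * K))ᴴ * X * (M * (N * K)) := by
    simp only [hZ, conjTranspose_mul, Matrix.mul_sub, Matrix.sub_mul, Matrix.mul_assoc]
  have hsplit : X - (M * (N * K))ᴴ * X * (M * (N * K)) =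
      (fromRows (1 - N * K) K)ᴴ * fromBlocks X 0 0 Z * fromRows (1 - N * K) K := by
    calc X - (M * (N * K))ᴴ * X * (M * (N * K))
        = (1 - N * K)ᴴ * X * (1 - N * K) + Kᴴ * Z * K := by
          rw [hZK, ← add_sub_assoc, ← hpyth]
      _ = _ := by
          simp [conjTranspose_fromRows_eq_fromCols_conjTranspose, fromCols_mul_fromBlocks,
            fromCols_mul_fromRows]
  rw [hsplit]
  exact (posDef_fromBlocks_diagonal hX hN).conjTranspose_mul_mul_same hinj

end OutputInjection

section Plant

variable {𝕜 χ : Type*} {p q r : ℕ} (P : Plant 𝕜 χ p q r)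

/-- The system matrix `[A B₁; C₁ D₁₁]` of the plant without control. -/
def Plant.openLoop : Matrix (χ ⊕ Fin p) (χ ⊕ Fin p) 𝕜 :=
  fromBlocks P.A P.B₁ P.C₁ P.D₁₁

/-- The column `[B₂; D₁₂]` of the system matrix, through which the control acts. -/
def Plant.control : Matrix (χ ⊕ Fin p) (Fin q) 𝕜 :=
  fromRows P.B₂ P.D₁₂

/-- The row `[C₂ D₂₁]` of the system matrix, which yields the measured output. -/
def Plant.observation : Matrix (Fin r) (χ ⊕ Fin p) 𝕜 :=
  fromCols P.C₂ P.D₂₁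

variable [RCLike 𝕜]

/-- The dual plant, whose system matrix is the conjugate transpose. Duality exchanges control and
observation. -/
def Plant.adjoint : Plant 𝕜 χ p r q where
  A := P.Aᴴ
  B₁ := P.C₁ᴴ
  B₂ := P.C₂ᴴ
  C₁ := P.B₁ᴴ
  C₂ := P.B₂ᴴ
  D₁₁ := P.D₁₁ᴴ
  D₁₂ := P.D₂₁ᴴ
  D₂₁ := P.D₁₂ᴴ
  D₂₂ := P.D₂₂ᴴ

/-- The dual controller, whose system matrix is the conjugate transpose. -/
def Controller.adjoint {κ : Type*} (K : Controller 𝕜 κ q r) : Controller 𝕜 κ r q where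
  A := K.Aᴴ
  B := K.Cᴴ
  C := K.Bᴴ
  D := K.Dᴴ

theorem Plant.openLoop_adjoint : P.adjoint.openLoop = P.openLoopᴴ :=
  (fromBlocks_conjTranspose ..).symm

theorem Plant.observation_adjoint : P.adjoint.observation = P.controlᴴ :=
  (conjTranspose_fromRows_eq_fromCols_conjTranspose ..).symm

theorem inv_one_sub_mul_mul {R a b : Type*} [CommRing R] [Fintype a] [Fintype b] [DecidableEq a]
    [DecidableEq b] (K : Matrix a b R) (D : Matrix b a R) :
    (1 - K * D)⁻¹ * K = K * (1 - D * K)⁻¹ := by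
  have hdet : (1 - K * D).det = (1 - D * K).det := det_one_sub_mul_comm K D
  by_cases h : IsUnit (1 - K * D).det
  · have hswap : K * (1 - D * K) = (1 - K * D) * K := by
      simp only [Matrix.mul_sub, Matrix.sub_mul, Matrix.mul_one, Matrix.one_mul, Matrix.mul_assoc]
    calc (1 - K * D)⁻¹ * K = (1 - K * D)⁻¹ * (K * (1 - D * K)) * (1 - D * K)⁻¹ := by
          rw [Matrix.mul_assoc, Matrix.mul_assoc K, Matrix.mul_nonsing_inv _ (hdet ▸ h),
            Matrix.mul_one]
      _ = K * (1 - D * K)⁻¹ := by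
          rw [hswap, Matrix.nonsing_inv_mul_cancel_left _ _ h]
  · rw [nonsing_inv_apply_not_isUnit _ h, nonsing_inv_apply_not_isUnit _ (hdet ▸ h),
      Matrix.zero_mul, Matrix.mul_zero]

theorem lowerLFT_conjTranspose {a b y u : Type*} [Fintype y] [Fintype u] [DecidableEq y]
    [DecidableEq u] (A : Matrix a b 𝕜) (B : Matrix a u 𝕜) (C : Matrix y b 𝕜) (D : Matrix y u 𝕜)
    (K : Matrix u y 𝕜) : (lowerLFT A B C D K)ᴴ = lowerLFT Aᴴ Cᴴ Bᴴ Dᴴ Kᴴ := by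
  have hpush : ((1 - K * D)⁻¹ * K)ᴴ = (1 - Kᴴ * Dᴴ)⁻¹ * Kᴴ := by
    rw [inv_one_sub_mul_mul, conjTranspose_mul, conjTranspose_nonsing_inv, conjTranspose_sub,
      conjTranspose_one, conjTranspose_mul]
  rw [lowerLFT, Matrix.mul_assoc B, conjTranspose_add, conjTranspose_mul, conjTranspose_mul B,
    hpush, lowerLFT]
  simp only [Matrix.mul_assoc]

theorem closedLoop_adjoint [Fintype χ] {κ : Type*} [Fintype κ] [DecidableEq κ]
    (K : Controller 𝕜 κ q r) : closedLoop P.adjoint K.adjoint = (closedLoop P K)ᴴ := by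
  simp [closedLoop, lowerLFT_conjTranspose, Plant.adjoint, Controller.adjoint,
    fromBlocks_conjTranspose, conjTranspose_fromRows_eq_fromCols_conjTranspose,
    conjTranspose_fromCols_eq_fromRows_conjTranspose]

end Plant

section LMI

variable {𝕜 : Type*} [RCLike 𝕜]

theorem posDef_fromBlocks_one_iff {ι κ : Type*} [Finite ι] [Fintype κ] [DecidableEq κ]
    {T : Matrix ι ι 𝕜} {b : Matrix ι κ 𝕜} :
    (fromBlocks T b bᴴ 1).PosDef ↔ (T - b * bᴴ).PosDef := by
  classical
  cases nonempty_fintype ι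
  let U : Matrix (ι ⊕ κ) (ι ⊕ κ) 𝕜 := fromBlocks 1 0 bᴴ 1
  have hU : IsUnit U := by simp [Matrix.isUnit_iff_isUnit_det, U]
  have hcongr : fromBlocks T b bᴴ 1 = star U * fromBlocks (T - b * bᴴ) 0 0 1 * U := by
    simp [U, star_eq_conjTranspose, fromBlocks_conjTranspose, fromBlocks_multiply]
  rw [hcongr, Matrix.IsUnit.posDef_star_left_conjugate_iff hU]
  exact ⟨fun h => h.submatrix Sum.inl_injective, fun h => posDef_fromBlocks_diagonal h .one⟩

variable {χ : Type*} [Fintype χ] {p q r c : ℕ} {P : Plant 𝕜 χ p q r}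
  {N : Matrix (χ ⊕ Fin p) (Fin c) 𝕜}

theorem xLMI_iff {X : Matrix χ χ 𝕜} :
    XLMI P N X ↔ (Nᴴ * (fromBlocks X 0 0 1 -
      P.openLoopᴴ * fromBlocks X 0 0 1 * P.openLoop) * N).PosDef := by
  set Φ := fromBlocks (P.Aᴴ * X * P.A - X) (P.Aᴴ * X * P.B₁)
    (P.B₁ᴴ * X * P.A) (P.B₁ᴴ * X * P.B₁ - 1) with hΦ
  set g := fromCols P.C₁ P.D₁₁ with hg
  have hgH : fromRows P.C₁ᴴ P.D₁₁ᴴ = gᴴ := by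
    rw [hg, conjTranspose_fromCols_eq_fromRows_conjTranspose]
  have hblocks : -((fromBlocks N 0 0 (1 : Matrix (Fin p) (Fin p) 𝕜))ᴴ *
      fromBlocks Φ gᴴ g (-1) * fromBlocks N 0 0 (1 : Matrix (Fin p) (Fin p) 𝕜)) =
      fromBlocks (-(Nᴴ * Φ * N)) (-(g * N)ᴴ) (-(g * N)ᴴ)ᴴ 1 := by
    simp [fromBlocks_conjTranspose, fromBlocks_multiply, fromBlocks_neg]
  have hstein : fromBlocks X 0 0 1 - P.openLoopᴴ * fromBlocks X 0 0 1 * P.openLoop =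
      -Φ - gᴴ * g := by
    rw [← hgH, Plant.openLoop, hΦ, hg, fromRows_mul_fromCols, fromBlocks_conjTranspose,
      fromBlocks_multiply, fromBlocks_multiply]
    simp only [sub_eq_add_neg, fromBlocks_neg, fromBlocks_add, Matrix.mul_zero, add_zero,
      zero_add, Matrix.mul_one]
    congr 1 <;> abel
  have hschur : -(Nᴴ * Φ * N) - -(g * N)ᴴ * (-(g * N)ᴴ)ᴴ = Nᴴ * (-Φ - gᴴ * g) * N := by
    simp [Matrix.mul_sub, Matrix.sub_mul, Matrix.mul_assoc]
  rw [XLMI, hgH, hblocks, posDef_fromBlocks_one_iff, hschur, hstein]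

theorem xLMI_adjoint_iff {Y : Matrix χ χ 𝕜} : XLMI P.adjoint N Y ↔ YLMI P N Y := by
  simp [XLMI, YLMI, Plant.adjoint]

theorem exists_pos_smul_eq_one {ι : Type*} [Fintype ι] [DecidableEq ι] {D : Matrix ι ι 𝕜}
    (hD : D.PosDef) (hcomm : D ∈ commutant Set.univ) : ∃ t : ℝ, 0 < t ∧ t • D = 1 := by
  rcases isEmpty_or_nonempty ι with hι | ⟨⟨i⟩⟩
  · exact ⟨1, one_pos, Subsingleton.elim _ _⟩
  · obtain ⟨y, rfl⟩ := mem_range_scalar_iff_commute_single'.2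
      fun i j => (hcomm (single i j 1) trivial).symm
    have hy : 0 < y := by simpa using hD.diag_pos (i := i)
    obtain ⟨x, hx, rfl⟩ := RCLike.pos_iff_exists_ofReal.1 hy
    refine ⟨x⁻¹, inv_pos.2 hx, ?_⟩
    ext i j
    by_cases h : i = j <;> simp [h, one_apply, hx.ne', RCLike.real_smul_eq_coe_mul]

theorem exists_pos_smul_eq_fromBlocks_one {ι κ : Type*} [Fintype ι] [Fintype κ] [DecidableEq κ]
    {S : Set (Matrix ι ι 𝕜)} (hS : 0 ∈ S) {W : Matrix (ι ⊕ κ) (ι ⊕ κ) 𝕜} (hW : W.PosDef)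
    (hWS : W ∈ commutant (blockDiagonalStructure S Set.univ)) :
    ∃ Y ∈ commutant S, Y.PosDef ∧ ∃ t : ℝ, 0 < t ∧ t • W = fromBlocks Y 0 0 1 := by
  obtain ⟨a, b, c, D, rfl⟩ : ∃ a b c D, W = fromBlocks a b c D :=
    ⟨_, _, _, _, (fromBlocks_toBlocks W).symm⟩
  have hblocks (E : Matrix ι ι 𝕜) (hE : E ∈ S) (F : Matrix κ κ 𝕜) :
      a * E = E * a ∧ b * F = E * b ∧ c * E = F * c ∧ D * F = F * D := by
    simpa [fromBlocks_multiply] using hWS _ ⟨E, hE, F, trivial, rfl⟩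
  obtain rfl : b = 0 := by simpa using (hblocks 0 hS 1).2.1
  obtain rfl : c = 0 := by simpa using (hblocks 0 hS 1).2.2.1.symm
  have ha : a.PosDef := hW.submatrix Sum.inl_injective
  have hD : D.PosDef := hW.submatrix Sum.inr_injective
  obtain ⟨t, ht, htD⟩ := exists_pos_smul_eq_one hD fun F _ => (hblocks 0 hS F).2.2.2
  refine ⟨t • a, fun E hE => ?_, ha.smul ht, t, ht, ?_⟩
  · rw [Matrix.smul_mul, Matrix.mul_smul, (hblocks E hE 0).1]
  · rw [fromBlocks_smul, htD, smul_zero, smul_zero]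

variable {S : Set (Matrix χ χ 𝕜)}

theorem exists_xLMI_of_posDef (hS : 0 ∈ S) {W : Matrix (χ ⊕ Fin p) (χ ⊕ Fin p) 𝕜}
    (hWS : W ∈ commutant (blockDiagonalStructure S Set.univ)) (hW : W.PosDef)
    (hstein : (Nᴴ * (W - P.openLoopᴴ * W * P.openLoop) * N).PosDef) :
    ∃ X ∈ commutant S, X.PosDef ∧ XLMI P N X := by
  obtain ⟨X, hXS, hX, t, ht, htW⟩ := exists_pos_smul_eq_fromBlocks_one hS hW hWS
  refine ⟨X, hXS, hX, xLMI_iff.2 ?_⟩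
  rw [← htW]
  convert hstein.smul ht using 1
  simp only [Matrix.mul_smul, Matrix.smul_mul, ← smul_sub]

end LMI

section Embedding

variable (𝕜 χ κ π : Type*)

/-- The isometry that embeds the plant coordinates `𝒳 ⊕ 𝒰₁` into the closed-loop coordinates
`(𝒳 ⊕ 𝒳_K) ⊕ 𝒰₁`. -/
def plantEmbedding [Zero 𝕜] [One 𝕜] [DecidableEq χ] [DecidableEq π] :
    Matrix ((χ ⊕ κ) ⊕ π) (χ ⊕ π) 𝕜 :=
  fromBlocks (fromRows 1 0) 0 0 1

/-- The isometry that embeds the controller state space `𝒳_K` into the closed-loop coordinates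
`(𝒳 ⊕ 𝒳_K) ⊕ 𝒰₁`. -/
def controllerEmbedding [Zero 𝕜] [One 𝕜] [DecidableEq κ] : Matrix ((χ ⊕ κ) ⊕ π) κ 𝕜 :=
  fromRows (fromRows 0 1) 0

variable [Semiring 𝕜] [StarRing 𝕜]

theorem conjTranspose_plantEmbedding [DecidableEq χ] [DecidableEq π] :
    (plantEmbedding 𝕜 χ κ π)ᴴ = fromBlocks (fromCols 1 0) 0 0 1 := by
  simp [plantEmbedding, fromBlocks_conjTranspose, conjTranspose_fromRows_eq_fromCols_conjTranspose]

theorem conjTranspose_controllerEmbedding [DecidableEq κ] :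
    (controllerEmbedding 𝕜 χ κ π)ᴴ = fromCols (fromCols 0 1) 0 := by
  simp [controllerEmbedding, conjTranspose_fromRows_eq_fromCols_conjTranspose]

variable [Fintype χ] [Fintype κ] [Fintype π]

theorem conjTranspose_controllerEmbedding_mul_self [DecidableEq κ] :
    (controllerEmbedding 𝕜 χ κ π)ᴴ * controllerEmbedding 𝕜 χ κ π = 1 := by
  rw [conjTranspose_controllerEmbedding, controllerEmbedding]
  simp [fromCols_mul_fromRows]

variable [DecidableEq χ] [DecidableEq π]

theorem conjTranspose_plantEmbedding_mul_self :
    (plantEmbedding 𝕜 χ κ π)ᴴ * plantEmbedding 𝕜 χ κ π = 1 := by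
  rw [conjTranspose_plantEmbedding, plantEmbedding]
  simp [fromBlocks_multiply, fromCols_mul_fromRows]

variable [DecidableEq κ]

theorem conjTranspose_controllerEmbedding_mul_plantEmbedding :
    (controllerEmbedding 𝕜 χ κ π)ᴴ * plantEmbedding 𝕜 χ κ π = 0 := by
  rw [conjTranspose_controllerEmbedding, plantEmbedding]
  simp [fromCols_mul_fromRows, fromCols_mul_fromBlocks]

theorem conjTranspose_plantEmbedding_mul_controllerEmbedding :
    (plantEmbedding 𝕜 χ κ π)ᴴ * controllerEmbedding 𝕜 χ κ π = 0 := by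
  simpa using congrArg conjTranspose
    (conjTranspose_controllerEmbedding_mul_plantEmbedding 𝕜 χ κ π)

theorem plantEmbedding_mul_conjTranspose_add_controllerEmbedding_mul_conjTranspose :
    plantEmbedding 𝕜 χ κ π * (plantEmbedding 𝕜 χ κ π)ᴴ +
      controllerEmbedding 𝕜 χ κ π * (controllerEmbedding 𝕜 χ κ π)ᴴ = 1 := by
  rw [conjTranspose_plantEmbedding, conjTranspose_controllerEmbedding, plantEmbedding,
    controllerEmbedding, fromBlocks_multiply]
  ext ((i | i) | i) ((j | j) | j) <;> simp [one_apply]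

end Embedding

section EmbeddingBlocks

variable {𝕜 χ κ π : Type*} [Semiring 𝕜] [Fintype χ] [Fintype κ] [Fintype π]
  (a : Matrix χ χ 𝕜) (k : Matrix κ κ 𝕜) (f : Matrix π π 𝕜)

theorem fromBlocks_mul_plantEmbedding [DecidableEq χ] [DecidableEq π] :
    fromBlocks (fromBlocks a 0 0 k) 0 0 f * plantEmbedding 𝕜 χ κ π =
      plantEmbedding 𝕜 χ κ π * fromBlocks a 0 0 f := by
  rw [plantEmbedding, fromBlocks_multiply, fromBlocks_multiply]
  simp [fromRows_mul, fromBlocks_mul_fromRows]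

variable [StarRing 𝕜]

theorem conjTranspose_plantEmbedding_mul_fromBlocks [DecidableEq χ] [DecidableEq π] :
    (plantEmbedding 𝕜 χ κ π)ᴴ * fromBlocks (fromBlocks a 0 0 k) 0 0 f =
      fromBlocks a 0 0 f * (plantEmbedding 𝕜 χ κ π)ᴴ := by
  simpa [fromBlocks_conjTranspose] using
    congrArg conjTranspose (fromBlocks_mul_plantEmbedding aᴴ kᴴ fᴴ)

theorem conjTranspose_controllerEmbedding_mul_fromBlocks [DecidableEq κ] :
    (controllerEmbedding 𝕜 χ κ π)ᴴ * fromBlocks (fromBlocks a 0 0 k) 0 0 f =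
      k * (controllerEmbedding 𝕜 χ κ π)ᴴ := by
  rw [conjTranspose_controllerEmbedding]
  simp [fromCols_mul_fromBlocks, mul_fromCols]

end EmbeddingBlocks

section ClosedLoop

variable {𝕜 χ κ : Type*} [RCLike 𝕜] [Fintype χ] [Fintype κ] [DecidableEq χ] [DecidableEq κ]
  {p q r : ℕ} (P : Plant 𝕜 χ p q r) (K : Controller 𝕜 κ q r)

local notation "ℰ" => plantEmbedding 𝕜 χ κ (Fin p)
local notation "𝒞" => controllerEmbedding 𝕜 χ κ (Fin p)

theorem closedLoop_eq :
    closedLoop P K = ℰ * P.openLoop * ℰᴴ + fromCols 𝒞 (ℰ * P.control) *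
      ((1 - fromBlocks K.A K.B K.C K.D * fromBlocks (0 : Matrix κ κ 𝕜) 0 0 P.D₂₂)⁻¹ *
        fromBlocks K.A K.B K.C K.D) * fromRows 𝒞ᴴ (P.observation * ℰᴴ) := by
  have hopen : fromBlocks (fromBlocks P.A 0 0 0) (fromRows P.B₁ 0) (fromCols P.C₁ 0) P.D₁₁ =
      ℰ * P.openLoop * ℰᴴ := by
    rw [conjTranspose_plantEmbedding, plantEmbedding, Plant.openLoop, fromBlocks_multiply,
      fromBlocks_multiply]
    ext ((i | i) | i) ((j | j) | j) <;> simp [fromRows_mul, mul_fromCols]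
  have hcontrol : fromRows (fromBlocks 0 P.B₂ 1 0) (fromCols 0 P.D₁₂) =
      fromCols 𝒞 (ℰ * P.control) := by
    rw [plantEmbedding, controllerEmbedding, Plant.control, fromBlocks_mul_fromRows]
    ext ((i | i) | i) (j | j) <;> simp [fromRows_mul]
  have hobserve : fromCols (fromBlocks 0 1 P.C₂ 0) (fromRows 0 P.D₂₁) =
      fromRows 𝒞ᴴ (P.observation * ℰᴴ) := by
    rw [conjTranspose_plantEmbedding, conjTranspose_controllerEmbedding, Plant.observation,
      fromCols_mul_fromBlocks]
    ext (i | i) ((j | j) | j) <;> simp [mul_fromCols]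
  rw [closedLoop, lowerLFT, hopen, hcontrol, hobserve]
  simp only [Matrix.mul_assoc]

theorem exists_closedLoop_mul_plantEmbedding_eq :
    ∃ Z : Matrix _ (Fin r) 𝕜, closedLoop P K * ℰ = ℰ * P.openLoop + Z * P.observation := by
  have hobserve : fromRows 𝒞ᴴ (P.observation * ℰᴴ) * ℰ =
      fromRows (0 : Matrix κ (Fin r) 𝕜) 1 * P.observation := by
    rw [fromRows_mul, fromRows_mul, conjTranspose_controllerEmbedding_mul_plantEmbedding,
      Matrix.mul_assoc, conjTranspose_plantEmbedding_mul_self, Matrix.mul_one, Matrix.one_mul,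
      Matrix.zero_mul]
  rw [closedLoop_eq, Matrix.add_mul, Matrix.mul_assoc (ℰ * P.openLoop),
    conjTranspose_plantEmbedding_mul_self, Matrix.mul_one, Matrix.mul_assoc _ (fromRows _ _),
    hobserve, ← Matrix.mul_assoc]
  exact ⟨_, rfl⟩

variable {K}

theorem closedLoop_of_strictlyProper (hK : K.D = 0) :
    closedLoop P K = ℰ * P.openLoop * ℰᴴ + ℰ * P.control * K.C * 𝒞ᴴ +
      𝒞 * K.B * P.observation * ℰᴴ + 𝒞 * (K.A + K.B * P.D₂₂ * K.C) * 𝒞ᴴ := by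
  have hinv : (1 - fromBlocks K.A K.B K.C K.D * fromBlocks (0 : Matrix κ κ 𝕜) 0 0 P.D₂₂)⁻¹ =
      fromBlocks 1 (K.B * P.D₂₂) 0 1 := by
    refine Matrix.inv_eq_right_inv ?_
    rw [← fromBlocks_one, fromBlocks_multiply, sub_eq_add_neg, fromBlocks_neg, fromBlocks_add,
      fromBlocks_multiply]
    simp [hK]
  rw [closedLoop_eq, hinv, hK, fromBlocks_multiply, fromCols_mul_fromBlocks, fromCols_mul_fromRows]
  simp only [Matrix.one_mul, Matrix.zero_mul, Matrix.mul_zero, Matrix.add_mul, Matrix.mul_add,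
    Matrix.mul_assoc, zero_add, add_zero]
  abel

end ClosedLoop

section Necessity

variable {𝕜 χ κ : Type*} [RCLike 𝕜] [Fintype χ] [Fintype κ] [DecidableEq χ] [DecidableEq κ]
  {p q r c : ℕ} {P : Plant 𝕜 χ p q r} {K : Controller 𝕜 κ q r} {S : Set (Matrix χ χ 𝕜)}
  {T : Set (Matrix ((χ ⊕ κ) ⊕ Fin p) ((χ ⊕ κ) ⊕ Fin p) 𝕜)}
  {N : Matrix (χ ⊕ Fin p) (Fin c) 𝕜}

theorem exists_xLMI_of_qStable_closedLoop (hS : 0 ∈ S) (hT : ∀ D ∈ T, Dᴴ ∈ T)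
    (hST : Intertwines (plantEmbedding 𝕜 χ κ (Fin p)) (blockDiagonalStructure S Set.univ) T)
    (hN : IsKernelMatrix N P.observation) (hK : QStable T (closedLoop P K)) :
    ∃ X ∈ commutant S, X.PosDef ∧ XLMI P N X := by
  obtain ⟨Z, hZ⟩ := exists_closedLoop_mul_plantEmbedding_eq P K
  obtain ⟨W, hWS, hW, hstein⟩ := hK.exists_posDef_of_intertwines hT hST
    (mulVec_injective_of_mul_eq_one (conjTranspose_plantEmbedding_mul_self ..)) hN.1
    (M' := P.openLoop) (by
      rw [← Matrix.mul_assoc, hZ, Matrix.add_mul, Matrix.mul_assoc Z, hN.mul_eq_zero,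
        Matrix.mul_zero, add_zero, Matrix.mul_assoc])
  exact exists_xLMI_of_posDef hS hWS hW hstein

theorem exists_yLMI_of_qStable_closedLoop (hS : 0 ∈ S) (hT : ∀ D ∈ T, Dᴴ ∈ T)
    (hST : Intertwines (plantEmbedding 𝕜 χ κ (Fin p)) (blockDiagonalStructure S Set.univ) T)
    (hN : IsKernelMatrix N P.controlᴴ) (hK : QStable T (closedLoop P K)) :
    ∃ Y ∈ commutant S, Y.PosDef ∧ YLMI P N Y := by
  simp only [← xLMI_adjoint_iff]
  rw [← P.observation_adjoint] at hN
  exact exists_xLMI_of_qStable_closedLoop (K := K.adjoint) hS hT hST hN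
    (closedLoop_adjoint P K ▸ hK.conjTranspose hT)

end Necessity

section Gains

variable {𝕜 χ : Type*} [RCLike 𝕜] [Fintype χ] [DecidableEq χ] {p q r c : ℕ}
  {P : Plant 𝕜 χ p q r} {S : Set (Matrix χ χ 𝕜)} {N : Matrix (χ ⊕ Fin p) (Fin c) 𝕜}

theorem exists_qStable_openLoop_add_mul_observation (hS : ∀ D ∈ S, Dᴴ ∈ S)
    (hN : IsKernelMatrix N P.observation) {X : Matrix χ χ 𝕜} (hXS : X ∈ commutant S)
    (hX : X.PosDef) (hLMI : XLMI P N X) :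
    ∃ L : Matrix (χ ⊕ Fin p) (Fin r) 𝕜,
      QStable (blockDiagonalStructure S Set.univ) (P.openLoop + L * P.observation) := by
  obtain ⟨L, hL⟩ := hN.exists_posDef_add_mul (posDef_fromBlocks_diagonal hX .one)
    (xLMI_iff.1 hLMI)
  have hS' := conjTranspose_mem_blockDiagonalStructure (κ := Fin p) hS (S' := Set.univ)
    fun _ _ => Set.mem_univ _
  refine ⟨L, (qStable_iff_exists_posDef hS').2 ⟨_,
    fromBlocks_mem_commutant_blockDiagonalStructure hXS fun D _ => ?_,
    posDef_fromBlocks_diagonal hX .one, hL⟩⟩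
  rw [Matrix.one_mul, Matrix.mul_one]

theorem exists_qStable_openLoop_add_control_mul (hS : ∀ D ∈ S, Dᴴ ∈ S)
    (hN : IsKernelMatrix N P.controlᴴ) {Y : Matrix χ χ 𝕜} (hYS : Y ∈ commutant S)
    (hY : Y.PosDef) (hLMI : YLMI P N Y) :
    ∃ F : Matrix (Fin q) (χ ⊕ Fin p) 𝕜,
      QStable (blockDiagonalStructure S Set.univ) (P.openLoop + P.control * F) := by
  obtain ⟨L, hL⟩ := exists_qStable_openLoop_add_mul_observation hS
    (P.observation_adjoint ▸ hN) hYS hY (xLMI_adjoint_iff.2 hLMI)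
  refine ⟨Lᴴ, ?_⟩
  simpa [Plant.openLoop_adjoint, Plant.observation_adjoint] using
    hL.conjTranspose (conjTranspose_mem_blockDiagonalStructure hS fun _ _ => Set.mem_univ _)

end Gains

section Observer

variable {𝕜 χ κ : Type*} [RCLike 𝕜] [Fintype χ] {p q r : ℕ}

/-- The observer-based controller with feedback gain `F` and output-injection gain `L`. Its state
estimates the state and the disturbance of the plant together; `J` identifies the controller state
space with the space `𝒳 ⊕ 𝒰₁` of these estimates. -/
def observerController (P : Plant 𝕜 χ p q r) (F : Matrix (Fin q) (χ ⊕ Fin p) 𝕜)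
    (L : Matrix (χ ⊕ Fin p) (Fin r) 𝕜) (J : Matrix (χ ⊕ Fin p) κ 𝕜) : Controller 𝕜 κ q r where
  A := Jᴴ * (P.openLoop + P.control * F + L * P.observation + L * P.D₂₂ * F) * J
  B := -(Jᴴ * L)
  C := F * J
  D := 0

variable [Fintype κ] [DecidableEq χ] [DecidableEq κ]

/-- The coordinates `(x, J ξ - x)` of the closed loop, where `x` is the state and disturbance of the
plant and `ξ` is the state of the controller. -/
def errorCoordinates (J : Matrix (χ ⊕ Fin p) κ 𝕜) :
    Matrix ((χ ⊕ Fin p) ⊕ (χ ⊕ Fin p)) ((χ ⊕ κ) ⊕ Fin p) 𝕜 :=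
  fromRows (plantEmbedding 𝕜 χ κ (Fin p))ᴴ
    (J * (controllerEmbedding 𝕜 χ κ (Fin p))ᴴ - (plantEmbedding 𝕜 χ κ (Fin p))ᴴ)

variable {J : Matrix (χ ⊕ Fin p) κ 𝕜}

local notation "ℰ" => plantEmbedding 𝕜 χ κ (Fin p)
local notation "𝒞" => controllerEmbedding 𝕜 χ κ (Fin p)

theorem errorCoordinates_mulVec_injective (hJ : Jᴴ * J = 1) :
    Function.Injective (errorCoordinates J).mulVec := by
  refine mulVec_injective_of_mul_eq_one (V := fromCols (ℰ + 𝒞 * Jᴴ) (𝒞 * Jᴴ)) ?_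
  have hJC : 𝒞 * Jᴴ * (J * 𝒞ᴴ) = 𝒞 * 𝒞ᴴ := by
    rw [Matrix.mul_assoc, ← Matrix.mul_assoc Jᴴ, hJ, Matrix.one_mul]
  rw [errorCoordinates, fromCols_mul_fromRows, Matrix.mul_sub, hJC, Matrix.add_mul,
    ← plantEmbedding_mul_conjTranspose_add_controllerEmbedding_mul_conjTranspose]
  abel

theorem closedLoop_observerController (P : Plant 𝕜 χ p q r) (F : Matrix (Fin q) (χ ⊕ Fin p) 𝕜)
    (L : Matrix (χ ⊕ Fin p) (Fin r) 𝕜) :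
    closedLoop P (observerController P F L J) =
      ℰ * (P.openLoop * ℰᴴ + P.control * F * (J * 𝒞ᴴ)) +
      𝒞 * Jᴴ * ((P.openLoop + P.control * F + L * P.observation) * (J * 𝒞ᴴ) -
        L * P.observation * ℰᴴ) := by
  rw [closedLoop_of_strictlyProper P rfl]
  simp only [observerController, Matrix.mul_add, Matrix.add_mul, Matrix.mul_sub, Matrix.mul_neg,
    Matrix.neg_mul, Matrix.mul_assoc]
  abel

theorem fromBlocks_mul_errorCoordinates (hJ : J * Jᴴ = 1) (P : Plant 𝕜 χ p q r)
    (F : Matrix (Fin q) (χ ⊕ Fin p) 𝕜) (L : Matrix (χ ⊕ Fin p) (Fin r) 𝕜) :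
    fromBlocks (P.openLoop + P.control * F) (P.control * F) 0 (P.openLoop + L * P.observation) *
        errorCoordinates J =
      errorCoordinates J * closedLoop P (observerController P F L J) := by
  have hplant : ℰᴴ * closedLoop P (observerController P F L J) =
      P.openLoop * ℰᴴ + P.control * F * (J * 𝒞ᴴ) := by
    rw [closedLoop_observerController, Matrix.mul_add, ← Matrix.mul_assoc,
      conjTranspose_plantEmbedding_mul_self, Matrix.one_mul, Matrix.mul_assoc 𝒞,
      ← Matrix.mul_assoc _ 𝒞, conjTranspose_plantEmbedding_mul_controllerEmbedding,
      Matrix.zero_mul, add_zero]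
  have hcontroller : J * 𝒞ᴴ * closedLoop P (observerController P F L J) =
      (P.openLoop + P.control * F + L * P.observation) * (J * 𝒞ᴴ) - L * P.observation * ℰᴴ := by
    rw [closedLoop_observerController, Matrix.mul_add, Matrix.mul_assoc J, ← Matrix.mul_assoc _ ℰ,
      conjTranspose_controllerEmbedding_mul_plantEmbedding, Matrix.zero_mul, Matrix.mul_zero,
      zero_add, Matrix.mul_assoc 𝒞, Matrix.mul_assoc J, ← Matrix.mul_assoc _ 𝒞,
      conjTranspose_controllerEmbedding_mul_self, Matrix.one_mul, ← Matrix.mul_assoc, hJ,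
      Matrix.one_mul]
  rw [errorCoordinates, fromRows_mul, Matrix.sub_mul, hplant, hcontroller, fromBlocks_mul_fromRows]
  congr 1
  · simp only [Matrix.add_mul, Matrix.mul_sub]
    abel
  · simp only [Matrix.add_mul, Matrix.mul_sub, Matrix.zero_mul]
    abel

variable {S : Set (Matrix χ χ 𝕜)} {T : Set (Matrix ((χ ⊕ κ) ⊕ Fin p) ((χ ⊕ κ) ⊕ Fin p) 𝕜)}

theorem errorCoordinates_mul_fromBlocks (hJ : J * Jᴴ = 1) (a : Matrix χ χ 𝕜)
    (f : Matrix (Fin p) (Fin p) 𝕜) :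
    errorCoordinates J * fromBlocks (fromBlocks a 0 0 (Jᴴ * fromBlocks a 0 0 f * J)) 0 0 f =
      fromBlocks (fromBlocks a 0 0 f) 0 0 (fromBlocks a 0 0 f) * errorCoordinates J := by
  have hJa : J * (Jᴴ * fromBlocks a 0 0 f * J * 𝒞ᴴ) = fromBlocks a 0 0 f * (J * 𝒞ᴴ) := by
    simp only [← Matrix.mul_assoc, hJ, Matrix.one_mul]
  rw [errorCoordinates, fromRows_mul, fromBlocks_mul_fromRows, Matrix.sub_mul, Matrix.mul_assoc J,
    conjTranspose_plantEmbedding_mul_fromBlocks, conjTranspose_controllerEmbedding_mul_fromBlocks,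
    hJa, Matrix.zero_mul, Matrix.zero_mul, add_zero, zero_add, Matrix.mul_sub]

theorem intertwines_errorCoordinates (hJ : J * Jᴴ = 1)
    (hT : ∀ D ∈ T, ∃ a ∈ S, ∃ f,
      D = fromBlocks (fromBlocks a 0 0 (Jᴴ * fromBlocks a 0 0 f * J)) 0 0 f) :
    Intertwines (errorCoordinates J) T (blockDiagonalStructure
      (blockDiagonalStructure S Set.univ) (blockDiagonalStructure S Set.univ)) := by
  intro D hD
  obtain ⟨a, ha, f, rfl⟩ := hT D hD
  have hg : fromBlocks a 0 0 f ∈ blockDiagonalStructure S Set.univ := ⟨a, ha, f, trivial, rfl⟩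
  refine ⟨_, ⟨_, hg, _, hg, rfl⟩, (errorCoordinates_mul_fromBlocks hJ a f).symm, ?_⟩
  simpa [fromBlocks_conjTranspose, Matrix.mul_assoc] using
    (errorCoordinates_mul_fromBlocks hJ aᴴ fᴴ).symm

theorem qStable_closedLoop_observerController (hJ : J * Jᴴ = 1) (hJ' : Jᴴ * J = 1)
    (hS : ∀ D ∈ S, Dᴴ ∈ S) (hT : ∀ D ∈ T, Dᴴ ∈ T)
    (hTS : ∀ D ∈ T, ∃ a ∈ S, ∃ f,
      D = fromBlocks (fromBlocks a 0 0 (Jᴴ * fromBlocks a 0 0 f * J)) 0 0 f)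
    {P : Plant 𝕜 χ p q r} {F : Matrix (Fin q) (χ ⊕ Fin p) 𝕜}
    {L : Matrix (χ ⊕ Fin p) (Fin r) 𝕜}
    (hF : QStable (blockDiagonalStructure S Set.univ) (P.openLoop + P.control * F))
    (hL : QStable (blockDiagonalStructure S Set.univ) (P.openLoop + L * P.observation)) :
    QStable T (closedLoop P (observerController P F L J)) := by
  have hfull := conjTranspose_mem_blockDiagonalStructure (κ := Fin p) hS (S' := Set.univ)
    fun _ _ => Set.mem_univ _
  exact (hF.fromBlocks_upper (P.control * F) hL).of_intertwines
    (conjTranspose_mem_blockDiagonalStructure hfull hfull) hT (intertwines_errorCoordinates hJ hTS)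
    (errorCoordinates_mulVec_injective hJ') (fromBlocks_mul_errorCoordinates hJ P F L)

end Observer

section Structures

variable {𝕜 : Type*} [RCLike 𝕜] {d : ℕ} {m n : Fin d → ℕ}

theorem conjTranspose_uncertainty (δ : (k : Fin d) → Matrix (Fin (m k)) (Fin (m k)) 𝕜) :
    (uncertainty m n δ)ᴴ = uncertainty m n fun k => (δ k)ᴴ := by
  simp [uncertainty, blockDiagonal'_conjTranspose, conjTranspose_kronecker]

theorem conjTranspose_mem_uncertaintyStructure :
    ∀ D ∈ uncertaintyStructure 𝕜 m n, Dᴴ ∈ uncertaintyStructure 𝕜 m n := by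
  rintro _ ⟨δ, rfl⟩
  exact ⟨_, (conjTranspose_uncertainty δ).symm⟩

theorem zero_mem_uncertaintyStructure : 0 ∈ uncertaintyStructure 𝕜 m n := by
  refine ⟨0, ?_⟩
  simp only [uncertainty, Pi.zero_apply, zero_kronecker]
  exact blockDiagonal'_zero

variable {nK : Fin d → ℕ} {p nf : ℕ}

theorem conjTranspose_mem_sharedClosedLoopStructure :
    ∀ D ∈ sharedClosedLoopStructure 𝕜 m n nK p nf,
      Dᴴ ∈ sharedClosedLoopStructure 𝕜 m n nK p nf := by
  rintro _ ⟨δ, δf, rfl⟩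
  exact ⟨fun k => (δ k)ᴴ, δfᴴ,
    by simp [fromBlocks_conjTranspose, conjTranspose_uncertainty, conjTranspose_kronecker]⟩

theorem intertwines_plantEmbedding :
    Intertwines (plantEmbedding 𝕜 (StateIdx m n) (ControllerIdx m nK p nf) (Fin p))
      (blockDiagonalStructure (uncertaintyStructure 𝕜 m n) Set.univ)
      (sharedClosedLoopStructure 𝕜 m n nK p nf) := by
  rintro _ ⟨_, ⟨δ, rfl⟩, f, -, rfl⟩
  refine ⟨_, ⟨δ, f, rfl⟩, fromBlocks_mul_plantEmbedding .., ?_⟩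
  simp only [fromBlocks_conjTranspose, conjTranspose_zero]
  exact fromBlocks_mul_plantEmbedding ..

/-- The permutation matrix that identifies the state space of a controller with `n_{Kk} = n_k` and
`n_f = 1`, which carries a copy of the plant state and a copy of the disturbance, with `𝒳 ⊕ 𝒰₁`. -/
def estimateIdentification (𝕜 : Type*) [RCLike 𝕜] (m n : Fin d → ℕ) (p : ℕ) :
    Matrix (StateIdx m n ⊕ Fin p) (ControllerIdx m n p 1) 𝕜 :=
  (1 : Matrix _ _ 𝕜).submatrix (Equiv.refl _)
    (Equiv.sumCongr (Equiv.refl (StateIdx m n)) (Equiv.prodUnique (Fin p) (Fin 1)))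

theorem estimateIdentification_mul_conjTranspose_self :
    estimateIdentification 𝕜 m n p * (estimateIdentification 𝕜 m n p)ᴴ = 1 := by
  rw [estimateIdentification, conjTranspose_submatrix, conjTranspose_one, submatrix_mul_equiv,
    Matrix.one_mul, submatrix_one_equiv]

theorem conjTranspose_estimateIdentification_mul_mul (a : Matrix (StateIdx m n) (StateIdx m n) 𝕜)
    (f : Matrix (Fin p) (Fin p) 𝕜) :
    (estimateIdentification 𝕜 m n p)ᴴ * fromBlocks a 0 0 f * estimateIdentification 𝕜 m n p =
      fromBlocks a 0 0 (f ⊗ₖ (1 : Matrix (Fin 1) (Fin 1) 𝕜)) := by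
  rw [estimateIdentification, conjTranspose_submatrix, conjTranspose_one, mul_submatrix_one,
    one_submatrix_mul]
  ext (i | i) (j | j) <;> simp [one_apply, eq_iff_true_of_subsingleton]

theorem conjTranspose_estimateIdentification_mul_self :
    (estimateIdentification 𝕜 m n p)ᴴ * estimateIdentification 𝕜 m n p = 1 := by
  simpa using conjTranspose_estimateIdentification_mul_mul (1 : Matrix (StateIdx m n) _ 𝕜)
    (1 : Matrix (Fin p) _ 𝕜)

theorem exists_eq_fromBlocks_of_mem_sharedClosedLoopStructure :
    ∀ D ∈ sharedClosedLoopStructure 𝕜 m n n p 1, ∃ a ∈ uncertaintyStructure 𝕜 m n, ∃ f,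
      D = fromBlocks (fromBlocks a 0 0 ((estimateIdentification 𝕜 m n p)ᴴ * fromBlocks a 0 0 f *
        estimateIdentification 𝕜 m n p)) 0 0 f := by
  rintro _ ⟨δ, f, rfl⟩
  exact ⟨_, ⟨δ, rfl⟩, f, by rw [conjTranspose_estimateIdentification_mul_mul]⟩

end Structures

theorem theorem4p1 {𝕜 : Type*} [RCLike 𝕜] {d : ℕ} (m n : Fin d → ℕ) {p q r : ℕ}
    (P : Plant 𝕜 (StateIdx m n) p q r)
    {c o : ℕ}
    (Nc : Matrix (StateIdx m n ⊕ Fin p) (Fin c) 𝕜)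
    (No : Matrix (StateIdx m n ⊕ Fin p) (Fin o) 𝕜)
    (hNc : IsKernelMatrix Nc (Matrix.fromCols P.B₂ᴴ P.D₁₂ᴴ))
    (hNo : IsKernelMatrix No (Matrix.fromCols P.C₂ P.D₂₁)) :
    (∃ (nK : Fin d → ℕ) (nf : ℕ) (K : Controller 𝕜 (ControllerIdx m nK p nf) q r),
        WellPosed P K ∧
          QStable (sharedClosedLoopStructure 𝕜 m n nK p nf) (closedLoop P K)) ↔
      ∃ X ∈ commutant (uncertaintyStructure 𝕜 m n),
        ∃ Y ∈ commutant (uncertaintyStructure 𝕜 m n),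
          X.PosDef ∧ Y.PosDef ∧ YLMI P Nc Y ∧ XLMI P No X := by
  have hNcontrol : IsKernelMatrix Nc P.controlᴴ := by
    rwa [← P.observation_adjoint]
  constructor
  · rintro ⟨nK, nf, K, -, hK⟩
    obtain ⟨X, hXS, hX, hXLMI⟩ := exists_xLMI_of_qStable_closedLoop zero_mem_uncertaintyStructure
      conjTranspose_mem_sharedClosedLoopStructure intertwines_plantEmbedding hNo hK
    obtain ⟨Y, hYS, hY, hYLMI⟩ := exists_yLMI_of_qStable_closedLoop zero_mem_uncertaintyStructure
      conjTranspose_mem_sharedClosedLoopStructure intertwines_plantEmbedding hNcontrol hK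
    exact ⟨X, hXS, Y, hYS, hX, hY, hYLMI, hXLMI⟩
  · rintro ⟨X, hXS, Y, hYS, hX, hY, hYLMI, hXLMI⟩
    obtain ⟨L, hL⟩ := exists_qStable_openLoop_add_mul_observation
      conjTranspose_mem_uncertaintyStructure hNo hXS hX hXLMI
    obtain ⟨F, hF⟩ := exists_qStable_openLoop_add_control_mul
      conjTranspose_mem_uncertaintyStructure hNcontrol hYS hY hYLMI
    refine ⟨n, 1, observerController P F L (estimateIdentification 𝕜 m n p), ?_, ?_⟩
    · simp [WellPosed, observerController]
    · exact qStable_closedLoop_observerController estimateIdentification_mul_conjTranspose_self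
        conjTranspose_estimateIdentification_mul_self conjTranspose_mem_uncertaintyStructure
        conjTranspose_mem_sharedClosedLoopStructure
        exists_eq_fromBlocks_of_mem_sharedClosedLoopStructure hF hL
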